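/- Let $p$ be a prime, $\overline{\mathbb{Q}}_p$ an algebraic closure of $\mathbb{Q}_p$, and $\mathbb{C}_p$ its completion with respect to the $p$-adic absolute value. Let $E\subset\overline{\mathbb{Q}}_p$ be a finite extension of $\mathbb{Q}_p$, and let $D\subset\mathbb{C}_p$ be a non-empty disk, i.e. a non-empty set of the form $\{x\in\mathbb{C}_p : |x-a|<r\}$ or $\{x\in\mathbb{C}_p : |x-a|\le r\}$ with $a\in\mathbb{C}_p$ and $r\in\mathbb{R}$. Assume that $D$ is defined over $E$, i.e. invariant under the absolute Galois group $\operatorname{Gal}(\overline{\mathbb{Q}}_p/E)$ acting on $\mathbb{C}_p$ by continuity. Then there are finite extensions $F$ of $E$ inside $\overline{\mathbb{Q}}_p$ with $F\cap D\neq\emptyset$; let $e$ be the smallest integer such that there is such an $F$ with ramification index $e_{F/E}=e$. Then $e=p^s$ for some integer $s\ge 0$, and there exists a finite extension $F\subset\overline{\mathbb{Q}}_p$ of $E$ with $[F:E]\le\max(1,p^{2s-1})$ and $F\cap D\neq\emptyset$. Moreover, if $s\le 1$, then every finite extension $F\subset\overline{\mathbb{Q}}_p$ of $E$ with $[F:E]\le\max(1,p^{2s-1})$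 and $F\cap D\neq\emptyset$ is totally ramified over $E$. -/

import Mathlib

/-- An automorphism of `PadicAlgCl p` over a subextension `E` of `ℚ_[p]` preserves the norm. -/
theorem norm_galois_apply {p : ℕ} [Fact p.Prime] {E : IntermediateField ℚ_[p] (PadicAlgCl p)}
    (σ : PadicAlgCl p ≃ₐ[E] PadicAlgCl p) (x : PadicAlgCl p) : ‖σ x‖ = ‖x‖ :=
  (spectralNorm_eq_of_equiv (σ.restrictScalars ℚ_[p]) x).symm

theorem continuous_galois {p : ℕ} [Fact p.Prime] {E : IntermediateField ℚ_[p] (PadicAlgCl p)}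
    (σ : PadicAlgCl p ≃ₐ[E] PadicAlgCl p) : Continuous (σ : PadicAlgCl p →+* PadicAlgCl p) :=
  (AddMonoidHomClass.isometry_of_norm (σ : PadicAlgCl p →+* PadicAlgCl p)
    (norm_galois_apply σ)).continuous

/-- The action of the absolute Galois group `G_E` on `ℂ_[p]`: the extension by continuity of
an automorphism of `PadicAlgCl p` over `E`. -/
noncomputable def galoisAction {p : ℕ} [Fact p.Prime]
    {E : IntermediateField ℚ_[p] (PadicAlgCl p)} (σ : PadicAlgCl p ≃ₐ[E] PadicAlgCl p) :
    ℂ_[p] →+* ℂ_[p] :=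
  UniformSpace.Completion.mapRingHom (σ : PadicAlgCl p →+* PadicAlgCl p) (continuous_galois σ)

theorem galoisAction_coe {p : ℕ} [Fact p.Prime] {E : IntermediateField ℚ_[p] (PadicAlgCl p)}
    (σ : PadicAlgCl p ≃ₐ[E] PadicAlgCl p) (x : PadicAlgCl p) :
    galoisAction σ (x : ℂ_[p]) = ((σ x : PadicAlgCl p) : ℂ_[p]) :=
  UniformSpace.Completion.mapRingHom_coe (continuous_galois σ) x

/-- A (nonempty) disk in `ℂ_[p]`, either open, `{x | |x - a| < r}`, or closed,
`{x | |x - a| ≤ r}`, with an arbitrary real number `r`. -/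
def IsPadicDisk {p : ℕ} [Fact p.Prime] (D : Set ℂ_[p]) : Prop :=
  D.Nonempty ∧ ∃ (a : ℂ_[p]) (r : ℝ), D = {x | ‖x - a‖ < r} ∨ D = {x | ‖x - a‖ ≤ r}

/-- `D` is defined over `E`: it is invariant under the absolute Galois group of `E`. -/
def IsDefinedOver {p : ℕ} [Fact p.Prime] (E : IntermediateField ℚ_[p] (PadicAlgCl p))
    (D : Set ℂ_[p]) : Prop :=
  ∀ σ : PadicAlgCl p ≃ₐ[E] PadicAlgCl p, galoisAction σ '' D = D

/-- The value group `|Kˣ|` of a subfield `K` of `PadicAlgCl p`. -/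
noncomputable def valueGroup {p : ℕ} [Fact p.Prime] (K : Subfield (PadicAlgCl p)) :
    Subgroup ℝˣ :=
  ((Units.map ((normHom : PadicAlgCl p →*₀ ℝ) : PadicAlgCl p →* ℝ)).comp
    (Units.map (K.subtype : K →* PadicAlgCl p))).range

/-- The ramification index `e_{F/E}` of an extension `F / E` inside `PadicAlgCl p`: the index
`(|Fˣ| : |Eˣ|)` of the value group of `E` in the value group of `F`. -/
noncomputable def ramificationIndex {p : ℕ} [Fact p.Prime]
    (E : IntermediateField ℚ_[p] (PadicAlgCl p)) (F : IntermediateField E (PadicAlgCl p)) : ℕ :=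
  (valueGroup E.toSubfield).relIndex (valueGroup F.toSubfield)

/-- The extension `F / E` is totally ramified: `e_{F/E} = [F : E]`. -/
def IsTotallyRamified {p : ℕ} [Fact p.Prime]
    (E : IntermediateField ℚ_[p] (PadicAlgCl p)) (F : IntermediateField E (PadicAlgCl p)) : Prop :=
  ramificationIndex E F = Module.finrank E F

/-- `F ∩ D ≠ ∅`, with `F` viewed in `ℂ_[p]` through `PadicAlgCl p`. -/
def Meets {p : ℕ} [Fact p.Prime] {E : IntermediateField ℚ_[p] (PadicAlgCl p)}
    (F : IntermediateField E (PadicAlgCl p)) (D : Set ℂ_[p]) : Prop :=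
  ∃ x ∈ F, (x : ℂ_[p]) ∈ D

/-! Take an algebraic point `a` of `D` of least degree `n` over `E`; the field `E⟮a⟯` settles every
claim.

The degree is a power of `p`. Write `n = p ^ k * m` with `p ∤ m`. If `m > 1`, the Hasse derivative
of order `p ^ k` of `minpoly E a` has leading coefficient prime to `p`, so it has a root no farther
from `a` than the farthest conjugate. That root lies in `D` and has smaller degree, a contradiction.

A nonzero polynomial over `E` of degree below `n` has no root in `D`, so its values on `D` all have
the same leading term. Hence the value group of `E⟮a⟯` embeds in that of every `F` meeting `D`.
Moreover a unit of `E⟮a⟯` is congruent to all its conjugates, so its norm is congruent to its `n`-th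
power; as Frobenius is bijective on a finite residue field, the unit is congruent to an element of
`E`. Thus `E⟮a⟯` is totally ramified and `e = n = p ^ s`, which already beats the bound `p ^ (2s -
1)` for `s ≥ 1`.

That `D` has an algebraic point is clear by density, except for radius `0`, where it is the
Ax-Sen-Tate theorem. -/

/-! ### Ultrametric estimates for products, roots and Hasse derivatives -/

open Polynomial in
/-- If `x` is closer to `y` than every element of `s`, then `∏ (x - b)` and `∏ (y - b)` have the
same leading term. -/
theorem norm_prod_sub_sub_prod_sub_lt {L : Type*} [NormedField L] [IsUltrametricDist L]
    (s : Multiset L) (x y : L) (h : ∀ b ∈ s, ‖x - y‖ < ‖y - b‖) :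
    ‖(s.map (x - ·)).prod - (s.map (y - ·)).prod‖ < ‖(s.map (y - ·)).prod‖ := by
  induction s using Multiset.induction with
  | empty => simp
  | cons b s ih =>
    have ih := ih fun c hc => h c (Multiset.mem_cons_of_mem hc)
    have hb := h b (Multiset.mem_cons_self b s)
    simp only [Multiset.map_cons, Multiset.prod_cons]
    set P := (s.map (x - ·)).prod
    set Q := (s.map (y - ·)).prod
    have hQ : 0 < ‖Q‖ := (norm_nonneg _).trans_lt ih
    have hP : ‖P‖ ≤ ‖Q‖ := by
      have := IsUltrametricDist.norm_add_le_max (P - Q) Q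
      rw [sub_add_cancel] at this
      exact this.trans (max_le ih.le le_rfl)
    have e : (x - b) * P - (y - b) * Q = (x - y) * P + (y - b) * (P - Q) := by ring
    rw [e, norm_mul]
    refine (IsUltrametricDist.norm_add_le_max _ _).trans_lt (max_lt ?_ ?_)
    · rw [norm_mul]
      exact (mul_le_mul_of_nonneg_left hP (norm_nonneg _)).trans_lt (mul_lt_mul_of_pos_right hb hQ)
    · rw [norm_mul]
      exact mul_lt_mul_of_pos_left ih ((norm_nonneg _).trans_lt hb)

open Polynomial in
theorem norm_coeff_prod_X_sub_C_le {L : Type*} [NormedField L] [IsUltrametricDist L]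
    (s : Multiset L) {ρ : ℝ} (hρ : 0 ≤ ρ) (h : ∀ b ∈ s, ‖b‖ ≤ ρ) (j : ℕ) :
    ‖((s.map (X - C ·)).prod).coeff j‖ ≤ ρ ^ (Multiset.card s - j) := by
  induction s using Multiset.induction generalizing j with
  | empty =>
    simp only [Multiset.map_zero, Multiset.prod_zero, coeff_one]
    split_ifs <;> simp
  | cons b s ih =>
    have ih := ih fun c hc => h c (Multiset.mem_cons_of_mem hc)
    have hb := h b (Multiset.mem_cons_self b s)
    simp only [Multiset.map_cons, Multiset.prod_cons, Multiset.card_cons]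
    have hdeg : (s.map (X - C ·)).prod.natDegree = Multiset.card s :=
      natDegree_multiset_prod_X_sub_C_eq_card s
    set P := (s.map (X - C ·)).prod
    rcases j with _ | j
    · rw [sub_mul, coeff_sub, coeff_C_mul, mul_coeff_zero, coeff_X_zero, zero_mul, zero_sub,
        norm_neg, norm_mul, Nat.sub_zero, pow_succ']
      exact mul_le_mul hb (ih 0) (norm_nonneg _) hρ
    · rw [sub_mul, coeff_sub, coeff_C_mul, coeff_X_mul, sub_eq_add_neg, Nat.add_sub_add_right]
      refine (IsUltrametricDist.norm_add_le_max _ _).trans (max_le (ih j) ?_)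
      rw [norm_neg, norm_mul]
      rcases lt_or_ge j (Multiset.card s) with hj | hj
      · have : Multiset.card s - j = Multiset.card s - (j + 1) + 1 := by omega
        rw [this, pow_succ']
        exact mul_le_mul hb (ih (j + 1)) (norm_nonneg _) hρ
      · rw [coeff_eq_zero_of_natDegree_lt (by omega)]
        simpa using pow_nonneg hρ _

theorem pow_card_le_norm_prod_sub {L : Type*} [NormedField L] (s : Multiset L) (x : L) {t : ℝ}
    (ht : 0 ≤ t) (h : ∀ b ∈ s, t ≤ ‖x - b‖) :
    t ^ Multiset.card s ≤ ‖(s.map (x - ·)).prod‖ := by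
  induction s using Multiset.induction with
  | empty => simp
  | cons b s ih =>
    simp only [Multiset.map_cons, Multiset.prod_cons, Multiset.card_cons, norm_mul, pow_succ']
    exact mul_le_mul (h b (Multiset.mem_cons_self b s))
      (ih fun c hc => h c (Multiset.mem_cons_of_mem hc)) (pow_nonneg ht _) (norm_nonneg _)

open Polynomial in
/-- If all roots of `f` are at distance at most `ρ` from `a`, then a Hasse derivative of `f` has a
root that is not much farther from `a`. -/
theorem exists_root_hasseDeriv_norm_le {L : Type*} [NormedField L] [IsUltrametricDist L]
    [IsAlgClosed L] [CharZero L] {f : L[X]} (hf : f.Monic) {q : ℕ} (hq : q < f.natDegree)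
    {a : L} {ρ : ℝ} (hρ : 0 ≤ ρ) (h : ∀ b ∈ f.roots, ‖a - b‖ ≤ ρ) :
    ∃ b ∈ (hasseDeriv q f).roots, ‖((f.natDegree.choose q : ℕ) : L)‖ *
      ‖a - b‖ ^ (f.natDegree - q) ≤ ρ ^ (f.natDegree - q) := by
  classical
  have hsplit := IsAlgClosed.splits f
  set g := hasseDeriv q f with hg
  have hgdeg : g.natDegree = f.natDegree - q := natDegree_hasseDeriv f q
  have hglc : g.leadingCoeff = (f.natDegree.choose q : ℕ) := by
    rw [leadingCoeff, hgdeg, hg, hasseDeriv_coeff, Nat.sub_add_cancel hq.le, hf.coeff_natDegree,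
      mul_one]
  have hcard : Multiset.card g.roots = f.natDegree - q := by
    rw [← hgdeg, ← (IsAlgClosed.splits g).natDegree_eq_card_roots]
  -- `g.eval a` is the `q`-th Taylor coefficient of `f` at `a`: up to sign, an elementary symmetric
  -- function of the differences `b - a`.
  have hle : ‖g.eval a‖ ≤ ρ ^ (f.natDegree - q) := by
    rw [hg, ← taylor_coeff]
    have : taylor a f = ((f.roots.map (· - a)).map (X - C ·)).prod := by
      conv_lhs => rw [hsplit.eq_prod_roots_of_monic hf]
      rw [taylor_apply, multiset_prod_comp, Multiset.map_map, Multiset.map_map]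
      congr 1
      refine Multiset.map_congr rfl fun b _ => ?_
      simp
      ring
    rw [this]
    have := norm_coeff_prod_X_sub_C_le (f.roots.map (· - a)) hρ (by
      intro b hb
      obtain ⟨c, hc, rfl⟩ := Multiset.mem_map.1 hb
      rw [norm_sub_rev]
      exact h c hc) q
    rwa [Multiset.card_map, ← hsplit.natDegree_eq_card_roots] at this
  have hne : g.roots.toFinset.Nonempty := by
    rw [Multiset.toFinset_nonempty, ← Multiset.card_pos, hcard]
    omega
  obtain ⟨b, hb, hmin⟩ := g.roots.toFinset.exists_min_image (fun b => ‖a - b‖) hne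
  refine ⟨b, Multiset.mem_toFinset.1 hb, le_trans ?_ hle⟩
  rw [(IsAlgClosed.splits g).eval_eq_prod_roots, norm_mul, hglc, ← hcard]
  exact mul_le_mul_of_nonneg_left (pow_card_le_norm_prod_sub _ _ (norm_nonneg _)
    fun c hc => hmin c (Multiset.mem_toFinset.2 hc)) (norm_nonneg _)

theorem norm_prod_sub_pow_card_lt_one {ι L : Type*} [NormedField L] [IsUltrametricDist L]
    (s : Finset ι) (f : ι → L) {y : L} (hy : ‖y‖ ≤ 1) (h : ∀ i ∈ s, ‖f i - y‖ < 1) :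
    ‖∏ i ∈ s, f i - y ^ s.card‖ < 1 := by
  classical
  induction s using Finset.induction with
  | empty => simp
  | insert i s hi ih =>
    have ih := ih fun j hj => h j (Finset.mem_insert_of_mem hj)
    have hfi := h i (Finset.mem_insert_self i s)
    rw [Finset.prod_insert hi, Finset.card_insert_of_notMem hi, pow_succ']
    have e : f i * ∏ j ∈ s, f j - y * y ^ s.card =
      f i * (∏ j ∈ s, f j - y ^ s.card) + (f i - y) * y ^ s.card := by ring
    have hf1 : ‖f i‖ ≤ 1 := by
      have := IsUltrametricDist.norm_add_le_max (f i - y) y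
      rw [sub_add_cancel] at this
      exact this.trans (max_le hfi.le hy)
    rw [e]
    refine (IsUltrametricDist.norm_add_le_max _ _).trans_lt (max_lt ?_ ?_)
    · rw [norm_mul]
      exact (mul_le_of_le_one_left (norm_nonneg _) hf1).trans_lt ih
    · rw [norm_mul, norm_pow]
      exact (mul_le_of_le_one_right (norm_nonneg _) (pow_le_one₀ (norm_nonneg _) hy)).trans_lt hfi

theorem norm_pow_sub_pow_lt_one {L : Type*} [NormedField L] [IsUltrametricDist L] {x y : L}
    (hy : ‖y‖ ≤ 1) (h : ‖x - y‖ < 1) (n : ℕ) : ‖x ^ n - y ^ n‖ < 1 := by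
  simpa using norm_prod_sub_pow_card_lt_one (Finset.range n) (fun _ => x) hy fun _ _ => h

-- The Hasse derivative of `minpoly E a` still has coefficients in `E`, so its degree bounds the
-- degree of the root found near `a`.
open Polynomial in
theorem exists_natDegree_minpoly_le {p : ℕ} [Fact p.Prime]
    {E : IntermediateField ℚ_[p] (PadicAlgCl p)} {a : PadicAlgCl p} {q : ℕ}
    (hq : q < (minpoly E a).natDegree) {ρ : ℝ} (hρ : 0 ≤ ρ)
    (h : ∀ b, IsConjRoot E a b → ‖a - b‖ ≤ ρ) :
    ∃ b : PadicAlgCl p, (minpoly E b).natDegree ≤ (minpoly E a).natDegree - q ∧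
      ‖(((minpoly E a).natDegree.choose q : ℕ) : PadicAlgCl p)‖ *
        ‖a - b‖ ^ ((minpoly E a).natDegree - q) ≤ ρ ^ ((minpoly E a).natDegree - q) := by
  have hint : IsIntegral E a := Algebra.IsIntegral.isIntegral a
  set f := (minpoly E a).map (algebraMap E (PadicAlgCl p)) with hf
  have hdeg : f.natDegree = (minpoly E a).natDegree := natDegree_map _
  obtain ⟨b, hb, hle⟩ := exists_root_hasseDeriv_norm_le ((minpoly.monic hint).map _)
    (hdeg.symm ▸ hq) hρ fun b hb => h b ((isConjRoot_iff_mem_minpoly_aroots hint).2 hb)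
  rw [← hf, hdeg] at hle
  refine ⟨b, ?_, hle⟩
  have hg : hasseDeriv q f = (hasseDeriv q (minpoly E a)).map (algebraMap E (PadicAlgCl p)) := by
    ext i
    simp [hf, hasseDeriv_coeff]
  have hg0 : hasseDeriv q (minpoly E a) ≠ 0 := by
    intro h0
    rw [← hf, hg, h0] at hb
    simp at hb
  rw [← hf, hg] at hb
  exact (natDegree_le_of_dvd (minpoly.dvd E b
    ((mem_aroots.1 hb).2)) hg0).trans (natDegree_hasseDeriv_le _ _)

/-! ### Value groups and the ramification index -/

theorem mem_valueGroup {p : ℕ} [Fact p.Prime] {K : Subfield (PadicAlgCl p)} {u : ℝˣ} :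
    u ∈ valueGroup K ↔ ∃ x ∈ K, ‖x‖ = u := by
  constructor
  · rintro ⟨x, rfl⟩
    exact ⟨x.1, x.1.2, rfl⟩
  · rintro ⟨x, hx, hu⟩
    have hx0 : x ≠ 0 := by
      rintro rfl
      exact u.ne_zero (by simpa using hu.symm)
    refine ⟨Units.mk0 ⟨x, hx⟩ fun h => hx0 (congrArg Subtype.val h), Units.ext hu⟩

/-- Representatives in `F` of the cosets of the value group of `E` are linearly independent. -/
theorem exists_linearIndependent_valueGroup {p : ℕ} [Fact p.Prime]
    (E : IntermediateField ℚ_[p] (PadicAlgCl p)) (F : IntermediateField E (PadicAlgCl p)) :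
    ∃ v : valueGroup F.toSubfield ⧸
        (valueGroup E.toSubfield).subgroupOf (valueGroup F.toSubfield) → F,
      LinearIndependent E v ∧
      ∀ y ∈ F, y ≠ 0 → ∃ i, ∃ b : E, ‖y‖ = ‖(b : PadicAlgCl p) * v i‖ := by
  have hex (q : valueGroup F.toSubfield ⧸
      (valueGroup E.toSubfield).subgroupOf (valueGroup F.toSubfield)) :
      ∃ x : F, ‖(x : PadicAlgCl p)‖ = ((q.out : valueGroup F.toSubfield) : ℝˣ) := by
    obtain ⟨x, hx, h⟩ := mem_valueGroup.1 q.out.2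
    exact ⟨⟨x, hx⟩, h⟩
  choose v hv using hex
  have hv0 (i) : 0 < ‖(v i : PadicAlgCl p)‖ := by
    refine lt_of_le_of_ne (norm_nonneg _) ?_
    rw [hv]
    exact (Units.ne_zero _).symm
  refine ⟨v, ?_, ?_⟩
  · have hne (i j) (b c : E) (hb : b ≠ 0)
        (h : ‖(b : PadicAlgCl p) * v i‖ = ‖(c : PadicAlgCl p) * v j‖) : i = j := by
      have hb' : 0 < ‖(b : PadicAlgCl p)‖ := by simpa using hb
      rw [← Quotient.out_eq' i, ← Quotient.out_eq' j]
      refine QuotientGroup.eq.2 (Subgroup.mem_subgroupOf.2 (mem_valueGroup.2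
        ⟨(b : PadicAlgCl p) / c, div_mem b.2 c.2, ?_⟩))
      rw [norm_mul, norm_mul] at h
      have hc' : 0 < ‖(c : PadicAlgCl p)‖ := by
        refine lt_of_le_of_ne (norm_nonneg _) fun h0 => ?_
        rw [← h0, zero_mul] at h
        exact (mul_pos hb' (hv0 i)).ne' h
      rw [norm_div, Subgroup.coe_mul, Subgroup.coe_inv, Units.val_mul, Units.val_inv_eq_inv_val,
        ← hv, ← hv, div_eq_iff hc'.ne']
      have := (hv0 i).ne'
      field_simp
      linarith
    rw [linearIndependent_iff']
    intro s g hg i hi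
    by_contra hgi
    have hg' : ∑ j ∈ s, (g j : PadicAlgCl p) * v j = 0 := by
      have := congrArg (Subtype.val : F → PadicAlgCl p) hg
      simpa [Algebra.smul_def] using this
    -- In a vanishing sum the largest norm occurs twice, but terms from distinct cosets have
    -- distinct norms.
    obtain ⟨m, hm, hmax⟩ := s.exists_max_image (fun j => ‖(g j : PadicAlgCl p) * v j‖) ⟨i, hi⟩
    have hpos : 0 < ‖(g m : PadicAlgCl p) * v m‖ := by
      refine lt_of_lt_of_le ?_ (hmax i hi)
      rw [norm_mul]
      exact mul_pos (by simpa using hgi) (hv0 i)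
    have hgm : g m ≠ 0 := by
      intro h0
      simp [h0] at hpos
    classical
    rw [← Finset.add_sum_erase s _ hm] at hg'
    have hEq := congrArg norm (eq_neg_of_add_eq_zero_left hg')
    rw [norm_neg] at hEq
    rcases (s.erase m).eq_empty_or_nonempty with he | he
    · rw [he, Finset.sum_empty, norm_zero] at hEq
      exact hpos.ne' hEq
    · obtain ⟨j, hj, hle⟩ := IsUltrametricDist.exists_norm_finsetSum_le_of_nonempty he
        (fun j => (g j : PadicAlgCl p) * v j)
      exact Finset.ne_of_mem_erase hj (hne m j (g m) (g j) hgm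
        (le_antisymm (hEq.le.trans hle) (hmax j (Finset.mem_of_mem_erase hj)))).symm
  · intro y hy hy0
    have hn : ‖y‖ ≠ 0 := norm_ne_zero_iff.2 hy0
    let u : valueGroup F.toSubfield := ⟨Units.mk0 ‖y‖ hn, mem_valueGroup.2 ⟨y, hy, rfl⟩⟩
    refine ⟨(u : valueGroup F.toSubfield ⧸ _), ?_⟩
    have := QuotientGroup.eq.1 (Quotient.out_eq' (u : valueGroup F.toSubfield ⧸
      (valueGroup E.toSubfield).subgroupOf (valueGroup F.toSubfield)))
    obtain ⟨b, hb, h⟩ := mem_valueGroup.1 (Subgroup.mem_subgroupOf.1 this)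
    refine ⟨⟨b, hb⟩, ?_⟩
    rw [norm_mul, h, hv, Subgroup.coe_mul, Subgroup.coe_inv, Units.val_mul,
      Units.val_inv_eq_inv_val, mul_comm _ (u.1 : ℝ), mul_assoc, inv_mul_cancel₀, mul_one]
    · rfl
    · exact Units.ne_zero _

/-- `Subgroup.relIndex` takes the value `0` on infinite index; independence of the coset
representatives excludes this. -/
theorem ramificationIndex_ne_zero_and_le {p : ℕ} [Fact p.Prime]
    (E : IntermediateField ℚ_[p] (PadicAlgCl p)) (F : IntermediateField E (PadicAlgCl p))
    [FiniteDimensional E F] :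
    ramificationIndex E F ≠ 0 ∧ ramificationIndex E F ≤ Module.finrank E F := by
  obtain ⟨v, hv, -⟩ := exists_linearIndependent_valueGroup E F
  have := hv.finite
  have := Fintype.ofFinite (valueGroup F.toSubfield ⧸
    (valueGroup E.toSubfield).subgroupOf (valueGroup F.toSubfield))
  have hc : ramificationIndex E F = Fintype.card (valueGroup F.toSubfield ⧸
      (valueGroup E.toSubfield).subgroupOf (valueGroup F.toSubfield)) := Nat.card_eq_fintype_card
  rw [hc]
  exact ⟨Fintype.card_ne_zero, hv.fintype_card_le_finrank⟩

theorem ramificationIndex_le_of_le {p : ℕ} [Fact p.Prime]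
    {E : IntermediateField ℚ_[p] (PadicAlgCl p)} {K F : IntermediateField E (PadicAlgCl p)}
    [FiniteDimensional E F] (h : valueGroup K.toSubfield ≤ valueGroup F.toSubfield) :
    ramificationIndex E K ≤ ramificationIndex E F :=
  Subgroup.relIndex_le_of_le_right h (ramificationIndex_ne_zero_and_le E F).1

/-! ### Points of minimal degree in a Galois-stable disk -/

/-- `S` has the properties of the algebraic points of a disk defined over `E`. -/
structure IsGaloisDisk {p : ℕ} [Fact p.Prime] (E : IntermediateField ℚ_[p] (PadicAlgCl p))
    (S : Set (PadicAlgCl p)) : Prop where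
  nonempty : S.Nonempty
  norm_sub_lt : ∀ x ∈ S, ∀ y ∈ S, ∀ z ∉ S, ‖x - y‖ < ‖x - z‖
  isConjRoot_mem : ∀ x ∈ S, ∀ y, IsConjRoot E x y → y ∈ S

/-- `a` is a point of `S` of minimal degree over `E`. -/
def IsMinDegree {p : ℕ} [Fact p.Prime] (E : IntermediateField ℚ_[p] (PadicAlgCl p))
    (S : Set (PadicAlgCl p)) (a : PadicAlgCl p) : Prop :=
  a ∈ S ∧ ∀ b ∈ S, (minpoly E a).natDegree ≤ (minpoly E b).natDegree

theorem IsGaloisDisk.exists_isMinDegree {p : ℕ} [Fact p.Prime]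
    {E : IntermediateField ℚ_[p] (PadicAlgCl p)} {S : Set (PadicAlgCl p)}
    (hS : IsGaloisDisk E S) : ∃ a, IsMinDegree E S a := by
  obtain ⟨a, ha, h⟩ := exists_minimalFor_of_wellFoundedLT (· ∈ S)
    (fun x => (minpoly E x).natDegree) hS.nonempty
  exact ⟨a, ha, fun b hb => (le_total _ _).elim id fun hle => h hb hle⟩

-- By minimality `f` has no root in `S`, so passing from `y` to `x` moves each factor `y - b` by
-- less than its norm.
open Polynomial in
theorem IsGaloisDisk.norm_aeval_sub_lt {p : ℕ} [Fact p.Prime]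
    {E : IntermediateField ℚ_[p] (PadicAlgCl p)} {S : Set (PadicAlgCl p)}
    (hS : IsGaloisDisk E S) {a : PadicAlgCl p} (ha : IsMinDegree E S a) {f : E[X]} (hf0 : f ≠ 0)
    (hf : f.natDegree < (minpoly E a).natDegree) {x y : PadicAlgCl p} (hx : x ∈ S) (hy : y ∈ S) :
    ‖aeval x f - aeval y f‖ < ‖aeval y f‖ := by
  have hs : (f.map (algebraMap E (PadicAlgCl p))).Splits := IsAlgClosed.splits _
  rw [hs.aeval_eq_prod_aroots, hs.aeval_eq_prod_aroots, ← mul_sub, norm_mul, norm_mul]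
  refine mul_lt_mul_of_pos_left (norm_prod_sub_sub_prod_sub_lt _ x y fun b hb => ?_)
    (norm_pos_iff.2 (by simpa using hf0))
  rw [norm_sub_rev x y]
  refine hS.norm_sub_lt y hy x hx b fun hbS => ?_
  exact absurd ((ha.2 b hbS).trans (natDegree_le_of_dvd
    (minpoly.dvd E b (mem_aroots.1 hb).2) hf0)) (not_le.2 hf)

open Polynomial IntermediateField in
theorem exists_aeval_eq_of_mem_adjoin_simple {K L : Type*} [Field K] [Field L] [Algebra K L]
    {a y : L} (ha : IsIntegral K a) (hy : y ∈ K⟮a⟯) :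
    ∃ f : K[X], f.natDegree < (minpoly K a).natDegree ∧ aeval a f = y := by
  rw [← mem_toSubalgebra, adjoin_simple_toSubalgebra_of_isAlgebraic ha.isAlgebraic,
    Algebra.adjoin_singleton_eq_range_aeval] at hy
  obtain ⟨g, rfl⟩ := hy
  exact ⟨g %ₘ minpoly K a, natDegree_modByMonic_lt _ (minpoly.monic ha) (minpoly.ne_one K a),
    aeval_modByMonic_eq_self_of_root (minpoly.aeval K a)⟩

-- An element of `E⟮a⟯` is `f(a)` with `f` of degree below that of `a`, and `f(x) ∈ F` has the same
-- norm.
open IntermediateField in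
theorem IsGaloisDisk.valueGroup_adjoin_le {p : ℕ} [Fact p.Prime]
    {E : IntermediateField ℚ_[p] (PadicAlgCl p)} {S : Set (PadicAlgCl p)}
    (hS : IsGaloisDisk E S) {a : PadicAlgCl p} (ha : IsMinDegree E S a)
    {F : IntermediateField E (PadicAlgCl p)} {x : PadicAlgCl p} (hxF : x ∈ F) (hx : x ∈ S) :
    valueGroup E⟮a⟯.toSubfield ≤ valueGroup F.toSubfield := by
  intro u hu
  obtain ⟨y, hy, hyu⟩ := mem_valueGroup.1 hu
  obtain ⟨f, hf, rfl⟩ := exists_aeval_eq_of_mem_adjoin_simple (Algebra.IsIntegral.isIntegral a) hy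
  have hf0 : f ≠ 0 := by
    rintro rfl
    exact u.ne_zero (by simpa using hyu.symm)
  have hlt := hS.norm_aeval_sub_lt ha hf0 hf hx ha.1
  refine mem_valueGroup.2 ⟨Polynomial.aeval x f, ?_, ?_⟩
  · have : Polynomial.aeval x f = F.val (Polynomial.aeval (⟨x, hxF⟩ : F) f) := by
      rw [← Polynomial.aeval_algHom_apply]
      rfl
    rw [this]
    exact (Polynomial.aeval (⟨x, hxF⟩ : F) f).2
  · rw [← hyu]
    have h1 : ‖Polynomial.aeval x f - Polynomial.aeval a f + Polynomial.aeval a f‖ =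
        max _ _ := IsUltrametricDist.norm_add_eq_max_of_norm_ne_norm hlt.ne
    rwa [sub_add_cancel, max_eq_right hlt.le] at h1

/-- Lucas' theorem strips a factor `p` from both arguments. For `p ∤ m` this makes the leading
coefficient of the Hasse derivative a unit. -/
theorem choose_prime_pow_mul_modEq {p : ℕ} [Fact p.Prime] (k m : ℕ) :
    (p ^ k * m).choose (p ^ k) ≡ m [MOD p] := by
  induction k with
  | zero => simp [Nat.ModEq]
  | succ k ih =>
    have h := Choose.choose_modEq_choose_mod_mul_choose_div_nat (p := p) (n := p ^ (k + 1) * m)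
      (k := p ^ (k + 1))
    have hp : 0 < p := (Fact.out : p.Prime).pos
    have e : p ^ (k + 1) * m = p * (p ^ k * m) := by ring
    rw [e, pow_succ', Nat.mul_mod_right, Nat.mul_mod_right, Nat.mul_div_cancel_left _ hp,
      Nat.mul_div_cancel_left _ hp, Nat.choose_self, one_mul] at h
    rw [e, pow_succ']
    exact h.trans ih

theorem PadicAlgCl.norm_natCast {p : ℕ} [Fact p.Prime] (n : ℕ) :
    ‖(n : PadicAlgCl p)‖ = ‖(n : ℚ_[p])‖ := by
  rw [← PadicAlgCl.norm_extends, map_natCast]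

theorem exists_isConjRoot_forall_norm_sub_le {p : ℕ} [Fact p.Prime]
    (E : IntermediateField ℚ_[p] (PadicAlgCl p)) (a : PadicAlgCl p) :
    ∃ b, IsConjRoot E a b ∧ ∀ c, IsConjRoot E a c → ‖a - c‖ ≤ ‖a - b‖ := by
  classical
  have hint : IsIntegral E a := Algebra.IsIntegral.isIntegral a
  have hmem (c) : c ∈ ((minpoly E a).aroots (PadicAlgCl p)).toFinset ↔ IsConjRoot E a c := by
    rw [Multiset.mem_toFinset, isConjRoot_iff_mem_minpoly_aroots hint]
  obtain ⟨b, hb, h⟩ := ((minpoly E a).aroots (PadicAlgCl p)).toFinset.exists_max_image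
    (fun c => ‖a - c‖) ⟨a, (hmem a).2 (IsConjRoot.refl)⟩
  exact ⟨b, (hmem b).1 hb, fun c hc => h c ((hmem c).2 hc)⟩

theorem IsGaloisDisk.natDegree_minpoly_eq_pow {p : ℕ} [hp : Fact p.Prime]
    {E : IntermediateField ℚ_[p] (PadicAlgCl p)} {S : Set (PadicAlgCl p)}
    (hS : IsGaloisDisk E S) {a : PadicAlgCl p} (ha : IsMinDegree E S a) :
    ∃ k, (minpoly E a).natDegree = p ^ k := by
  have hn : 0 < (minpoly E a).natDegree :=
    minpoly.natDegree_pos (Algebra.IsIntegral.isIntegral a)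
  obtain ⟨k, m, hm, hnm⟩ := Nat.exists_eq_pow_mul_and_not_dvd hn.ne' p hp.out.ne_one
  refine ⟨k, ?_⟩
  by_contra hne
  have hpk : 0 < p ^ k := pow_pos hp.out.pos k
  have hm1 : 1 < m := by
    rcases m with _ | _ | m
    · simp at hm
    · simp [hnm] at hne
    · omega
  have hq : p ^ k < (minpoly E a).natDegree := by
    rw [hnm]
    exact lt_mul_of_one_lt_right hpk hm1
  obtain ⟨b, hb, hmax⟩ := exists_isConjRoot_forall_norm_sub_le E a
  obtain ⟨c, hcdeg, hc⟩ := exists_natDegree_minpoly_le hq (norm_nonneg _) hmax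
  -- Too small a degree keeps `c` out of `S`, hence farther from `a` than the conjugate `b`; the
  -- unit leading coefficient says the opposite.
  have hcS : c ∉ S := fun hcS => absurd ((ha.2 c hcS).trans hcdeg) (by omega)
  have hlt := hS.norm_sub_lt a ha.1 b (hS.isConjRoot_mem a ha.1 b hb) c hcS
  have h1 : ‖(((minpoly E a).natDegree.choose (p ^ k) : ℕ) : PadicAlgCl p)‖ = 1 := by
    rw [PadicAlgCl.norm_natCast, Padic.norm_natCast_eq_one_iff, hp.out.coprime_iff_not_dvd, hnm,
      (choose_prime_pow_mul_modEq k m).dvd_iff dvd_rfl]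
    exact hm
  rw [h1, one_mul] at hc
  exact absurd hc (not_le.2 (pow_lt_pow_left₀ hlt (norm_nonneg _) (by omega)))

/-! ### Residues and total ramification -/

/-- Frobenius is injective on the residue field, since `p`-power maps are additive modulo `p`. -/
theorem norm_sub_pow_prime_pow_lt_one {p : ℕ} [hp : Fact p.Prime] {x y : PadicAlgCl p} {n : ℕ}
    (hx : ‖x‖ ≤ 1) (hy : ‖y‖ ≤ 1) (h : ‖x ^ p ^ n - y ^ p ^ n‖ < 1) : ‖x - y‖ < 1 := by
  have hxy : ‖x - y‖ ≤ 1 := by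
    rw [sub_eq_add_neg]
    exact (IsUltrametricDist.norm_add_le_max _ _).trans (max_le hx (by rwa [norm_neg]))
  let O := (NormedField.valuation (K := PadicAlgCl p)).integer
  have hO {z : PadicAlgCl p} (hz : ‖z‖ ≤ 1) : z ∈ O := hz
  obtain ⟨r, hr⟩ := exists_add_pow_prime_pow_eq hp.out (⟨x - y, hO hxy⟩ : O) ⟨y, hO hy⟩ n
  have hr' := congrArg (Subtype.val : O → PadicAlgCl p) hr
  simp only [Subring.coe_pow, Subring.coe_add, Subring.coe_mul, sub_add_cancel,
    Subring.coe_natCast] at hr'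
  have hr1 : ‖(r : PadicAlgCl p)‖ ≤ 1 := r.2
  have hp1 : ‖(p : PadicAlgCl p)‖ < 1 := by
    rw [PadicAlgCl.norm_natCast]
    exact Padic.norm_p_lt_one
  have e : (x - y) ^ p ^ n = (x ^ p ^ n - y ^ p ^ n) + -(p * (x - y) * y * r) := by
    rw [hr']
    ring
  have : ‖x - y‖ ^ p ^ n < 1 := by
    rw [← norm_pow, e]
    refine (IsUltrametricDist.norm_add_le_max _ _).trans_lt (max_lt h ?_)
    rw [norm_neg, norm_mul, norm_mul, norm_mul]
    refine lt_of_le_of_lt ?_ hp1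
    have h1 : ‖(p : PadicAlgCl p)‖ * ‖x - y‖ ≤ ‖(p : PadicAlgCl p)‖ :=
      mul_le_of_le_one_right (norm_nonneg _) hxy
    have h2 : ‖(p : PadicAlgCl p)‖ * ‖x - y‖ * ‖y‖ ≤ ‖(p : PadicAlgCl p)‖ * ‖x - y‖ :=
      mul_le_of_le_one_right (by positivity) hy
    have h3 : ‖(p : PadicAlgCl p)‖ * ‖x - y‖ * ‖y‖ * ‖(r : PadicAlgCl p)‖ ≤
        ‖(p : PadicAlgCl p)‖ * ‖x - y‖ * ‖y‖ := mul_le_of_le_one_right (by positivity) hr1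
    linarith
  exact (pow_lt_one_iff_of_nonneg (norm_nonneg _) (pow_ne_zero _ hp.out.ne_zero)).1 this

/-- In a finite-dimensional subspace, a bounded sequence has two terms that are close. -/
theorem exists_lt_norm_sub_lt_one {p : ℕ} [Fact p.Prime] (W : Submodule ℚ_[p] (PadicAlgCl p))
    [FiniteDimensional ℚ_[p] W] (x : ℕ → PadicAlgCl p) (hW : ∀ n, x n ∈ W) (hx : ∀ n, ‖x n‖ ≤ 1) :
    ∃ i j, i < j ∧ ‖x i - x j‖ < 1 := by
  have := FiniteDimensional.proper ℚ_[p] W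
  obtain ⟨a, -, φ, hφ, h⟩ := (isCompact_closedBall (0 : W) 1).tendsto_subseq
    (x := fun n => ⟨x n, hW n⟩) fun n => by simpa using hx n
  obtain ⟨N, hN⟩ := Metric.cauchySeq_iff'.1 h.cauchySeq 1 one_pos
  refine ⟨φ N, φ (N + 1), hφ N.lt_succ_self, ?_⟩
  rw [norm_sub_rev]
  simpa [Subtype.dist_eq, dist_eq_norm] using hN (N + 1) N.le_succ

theorem exists_forall_norm_sub_le {p : ℕ} [Fact p.Prime] (W : Submodule ℚ_[p] (PadicAlgCl p))
    [FiniteDimensional ℚ_[p] W] (y : PadicAlgCl p) :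
    ∃ v ∈ W, ∀ w ∈ W, ‖y - v‖ ≤ ‖y - w‖ := by
  have := FiniteDimensional.proper ℚ_[p] W
  obtain ⟨v, -, hv⟩ := (isCompact_closedBall (0 : W) ‖y‖).exists_isMinOn
    ⟨0, by simp⟩ (f := fun w : W => ‖y - w‖) (by fun_prop)
  refine ⟨v, v.2, fun w hw => ?_⟩
  rcases le_or_gt ‖w‖ ‖y‖ with h | h
  · exact hv (a := (⟨w, hw⟩ : W)) (by simpa using h)
  · have h0 : ‖y - v‖ ≤ ‖y - (0 : W)‖ := hv (by simp)
    have h1 : ‖y + -w‖ = max ‖y‖ ‖-w‖ :=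
      IsUltrametricDist.norm_add_eq_max_of_norm_ne_norm (by rw [norm_neg]; exact h.ne)
    rw [norm_neg, max_eq_right h.le, ← sub_eq_add_neg] at h1
    rw [h1]
    simp only [ZeroMemClass.coe_zero, sub_zero] at h0
    exact h0.trans h.le

theorem norm_pow_prime_pow_sub_lt_one {p : ℕ} [Fact p.Prime] {y : PadicAlgCl p} (hy : ‖y‖ ≤ 1)
    {N : ℕ} (h : ‖y ^ p ^ N - y‖ < 1) (k : ℕ) : ‖y ^ p ^ (k * N) - y‖ < 1 := by
  induction k with
  | zero => simp
  | succ k ih =>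
    have e : y ^ p ^ ((k + 1) * N) - y =
        ((y ^ p ^ N) ^ p ^ (k * N) - y ^ p ^ (k * N)) + (y ^ p ^ (k * N) - y) := by
      rw [← pow_mul, ← pow_add, add_one_mul, add_comm N]
      ring
    rw [e]
    exact (IsUltrametricDist.norm_add_le_max _ _).trans_lt
      (max_lt (norm_pow_sub_pow_lt_one hy h _) ih)

/-- If the degree of `F` over `E` is a power of `p` and all embeddings of `F` move the unit `y` by
less than `1`, then `y` is congruent to an element of `E`. -/
theorem exists_norm_sub_algebraMap_lt_one {p : ℕ} [hp : Fact p.Prime]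
    {E : IntermediateField ℚ_[p] (PadicAlgCl p)} [FiniteDimensional ℚ_[p] E]
    {F : IntermediateField E (PadicAlgCl p)} [FiniteDimensional E F] {k : ℕ}
    (hk : Module.finrank E F = p ^ k) {y : F} (hy : ‖(y : PadicAlgCl p)‖ ≤ 1)
    (h : ∀ σ : F →ₐ[E] PadicAlgCl p, ‖σ y - y‖ < 1) :
    ∃ u : E, ‖(y : PadicAlgCl p) - u‖ < 1 := by
  have hnorm : ‖((Algebra.norm E y : E) : PadicAlgCl p) - (y : PadicAlgCl p) ^ p ^ k‖ < 1 := by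
    have h1 : ((Algebra.norm E y : E) : PadicAlgCl p) = ∏ σ : F →ₐ[E] PadicAlgCl p, σ y :=
      Algebra.norm_eq_prod_embeddings E (PadicAlgCl p) y
    have h2 := norm_prod_sub_pow_card_lt_one Finset.univ
      (fun σ : F →ₐ[E] PadicAlgCl p => σ y) hy fun σ _ => h σ
    rwa [Finset.card_univ, AlgHom.card, hk, ← h1] at h2
  have hfin : FiniteDimensional ℚ_[p] F := Module.Finite.trans E F
  let W := Subalgebra.toSubmodule (F.restrictScalars ℚ_[p]).toSubalgebra
  have : FiniteDimensional ℚ_[p] W := hfin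
  -- Compactness replaces finiteness of the residue field: two Frobenius iterates of `y` agree, so
  -- by injectivity some iterate fixes its residue.
  obtain ⟨i, j, hij, hlt⟩ := exists_lt_norm_sub_lt_one W
    (fun n => (y : PadicAlgCl p) ^ p ^ n) (fun n => (y ^ p ^ n).2)
    fun n => by
      rw [norm_pow]
      exact pow_le_one₀ (norm_nonneg _) hy
  obtain ⟨N, rfl⟩ := Nat.exists_eq_add_of_lt hij
  have hyN : ‖(y : PadicAlgCl p) ^ p ^ (N + 1) - y‖ < 1 := by
    refine norm_sub_pow_prime_pow_lt_one (n := i) ?_ hy ?_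
    · rw [norm_pow]
      exact pow_le_one₀ (norm_nonneg _) hy
    · rw [norm_sub_rev, ← pow_mul, ← pow_add, add_comm (N + 1)]
      exact hlt
  -- The norm is congruent to `y ^ p ^ k`; the extra `k * N` Frobenius steps complete `k * (N + 1)`,
  -- a multiple of the period `N + 1`.
  refine ⟨Algebra.norm E y ^ p ^ (k * N), ?_⟩
  have h1 := norm_pow_prime_pow_sub_lt_one hy hyN k
  have h2 := norm_pow_sub_pow_lt_one (by
    rw [norm_pow]
    exact pow_le_one₀ (norm_nonneg _) hy) hnorm (p ^ (k * N))
  rw [← pow_mul, ← pow_add, ← mul_one_add, add_comm 1] at h2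
  rw [norm_sub_rev, IntermediateField.coe_pow]
  have e := IsUltrametricDist.norm_add_le_max
    (((Algebra.norm E y : E) : PadicAlgCl p) ^ p ^ (k * N) - (y : PadicAlgCl p) ^ p ^ (k * (N + 1)))
    ((y : PadicAlgCl p) ^ p ^ (k * (N + 1)) - y)
  rw [sub_add_sub_cancel] at e
  exact e.trans_lt (max_lt h2 h1)

/-- An extension without residue extension is totally ramified. -/
theorem finrank_le_ramificationIndex {p : ℕ} [Fact p.Prime]
    {E : IntermediateField ℚ_[p] (PadicAlgCl p)} [FiniteDimensional ℚ_[p] E]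
    {F : IntermediateField E (PadicAlgCl p)} [FiniteDimensional E F]
    (h : ∀ y ∈ F, ‖y‖ = 1 → ∃ u : E, ‖y - u‖ < 1) :
    Module.finrank E F ≤ ramificationIndex E F := by
  obtain ⟨v, hv, hex⟩ := exists_linearIndependent_valueGroup E F
  have := hv.finite
  have := Fintype.ofFinite (valueGroup F.toSubfield ⧸
    (valueGroup E.toSubfield).subgroupOf (valueGroup F.toSubfield))
  have hc : ramificationIndex E F = Fintype.card (valueGroup F.toSubfield ⧸
      (valueGroup E.toSubfield).subgroupOf (valueGroup F.toSubfield)) := Nat.card_eq_fintype_card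
  rw [hc]
  refine finrank_le_of_span_eq_top (v := v) ?_
  have hfin : FiniteDimensional ℚ_[p] F := Module.Finite.trans E F
  let V : Submodule E F := Submodule.span E (Set.range v)
  let W : Submodule ℚ_[p] (PadicAlgCl p) := (V.map F.val.toLinearMap).restrictScalars ℚ_[p]
  have : FiniteDimensional ℚ_[p] W := by
    have : FiniteDimensional ℚ_[p]
      (Subalgebra.toSubmodule (F.restrictScalars ℚ_[p]).toSubalgebra) := hfin
    refine Submodule.finiteDimensional_of_le
      (S₂ := Subalgebra.toSubmodule (F.restrictScalars ℚ_[p]).toSubalgebra) ?_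
    rintro _ ⟨x, -, rfl⟩
    exact x.2
  rw [eq_top_iff]
  rintro y -
  -- If the best approximation `w` in the span is not `y`, then `y - w` is a unit times some `b * v
  -- i`; replacing the unit by a congruent `u : E` gives a better one.
  obtain ⟨w, hw, hmin⟩ := exists_forall_norm_sub_le W y
  obtain ⟨w, hwV, rfl⟩ := hw
  have hmin : ∀ x ∈ V, ‖(y - w : PadicAlgCl p)‖ ≤ ‖(y - x : PadicAlgCl p)‖ :=
    fun x hx => hmin x ⟨x, hx, rfl⟩
  by_cases hyw : y - w = 0
  · rw [sub_eq_zero.1 hyw]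
    exact hwV
  exfalso
  have hyw0 : ((y - w : F) : PadicAlgCl p) ≠ 0 := fun h0 => hyw (Subtype.ext h0)
  obtain ⟨i, b, hib⟩ := hex _ (y - w).2 hyw0
  have hbv : (b : PadicAlgCl p) * v i ≠ 0 := by
    rw [← norm_ne_zero_iff, ← hib]
    exact norm_ne_zero_iff.2 hyw0
  have hmem : ((y - w : F) : PadicAlgCl p) / (b * v i) ∈ F :=
    div_mem (y - w).2 (mul_mem (F.algebraMap_mem b) (v i).2)
  obtain ⟨u, hu⟩ := h _ hmem (by
    rw [norm_div, hib]
    exact div_self (norm_ne_zero_iff.2 hbv))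
  have hx := hmin (w + (u * b) • v i)
    (V.add_mem hwV (V.smul_mem _ (Submodule.subset_span ⟨i, rfl⟩)))
  have e : (y - (w + (u * b) • v i : F) : PadicAlgCl p) =
      (((y - w : F) : PadicAlgCl p) / (b * v i) - u) * (b * v i) := by
    rw [sub_mul, div_mul_cancel₀ _ hbv]
    simp [Algebra.smul_def]
    ring
  rw [e, norm_mul, ← hib] at hx
  have h0 : 0 < ‖((y - w : F) : PadicAlgCl p)‖ := norm_pos_iff.2 hyw0
  exact absurd (hx.trans_lt (mul_lt_of_lt_one_left h0 hu)) (lt_irrefl _)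

-- The conjugates of `f(a)` are values of `f` at conjugates of `a`, which lie in `S`; so a unit of
-- `E⟮a⟯` is congruent to all its conjugates.
open IntermediateField in
theorem IsGaloisDisk.finrank_adjoin_le_ramificationIndex {p : ℕ} [hp : Fact p.Prime]
    {E : IntermediateField ℚ_[p] (PadicAlgCl p)} [FiniteDimensional ℚ_[p] E]
    {S : Set (PadicAlgCl p)} (hS : IsGaloisDisk E S) {a : PadicAlgCl p}
    (ha : IsMinDegree E S a) :
    Module.finrank E E⟮a⟯ ≤ ramificationIndex E E⟮a⟯ := by
  have hint : IsIntegral E a := Algebra.IsIntegral.isIntegral a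
  have := adjoin.finiteDimensional hint
  obtain ⟨k, hk⟩ := hS.natDegree_minpoly_eq_pow ha
  refine finrank_le_ramificationIndex fun y hy hy1 => ?_
  refine exists_norm_sub_algebraMap_lt_one (k := k) (y := ⟨y, hy⟩)
    ((adjoin.finrank hint).trans hk) hy1.le fun σ => ?_
  obtain ⟨f, hf, hfy⟩ := exists_aeval_eq_of_mem_adjoin_simple hint hy
  have hf0 : f ≠ 0 := by
    rintro rfl
    simp [← hfy] at hy1
  have hgen : (⟨y, hy⟩ : E⟮a⟯) = Polynomial.aeval (AdjoinSimple.gen E a) f := by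
    ext
    refine hfy.symm.trans ?_
    simp
  have hσ : σ ⟨y, hy⟩ = Polynomial.aeval (σ (AdjoinSimple.gen E a)) f := by
    rw [hgen, Polynomial.aeval_algHom_apply]
  have hconj : IsConjRoot E a (σ (AdjoinSimple.gen E a)) := by
    refine isConjRoot_of_aeval_eq_zero hint ?_
    rw [← minpoly_gen E a, Polynomial.aeval_algHom_apply, minpoly.aeval, map_zero]
  have := hS.norm_aeval_sub_lt ha hf0 hf (hS.isConjRoot_mem a ha.1 _ hconj) ha.1
  rwa [hfy, hy1, ← hσ] at this

/-! ### From disks in `ℂ_[p]` to their algebraic points -/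

theorem isometry_galoisAction {p : ℕ} [Fact p.Prime]
    {E : IntermediateField ℚ_[p] (PadicAlgCl p)} (σ : PadicAlgCl p ≃ₐ[E] PadicAlgCl p) :
    Isometry (galoisAction σ) :=
  (AddMonoidHomClass.isometry_of_norm (σ : PadicAlgCl p →+* PadicAlgCl p)
    (norm_galois_apply σ)).isometry_mapRingHom

theorem PadicComplex.norm_coe_sub_coe {p : ℕ} [Fact p.Prime] (x y : PadicAlgCl p) :
    ‖(x : ℂ_[p]) - y‖ = ‖x - y‖ := by
  rw [← dist_eq_norm, ← dist_eq_norm, UniformSpace.Completion.dist_eq]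

theorem PadicComplex.exists_norm_coe_sub_lt {p : ℕ} [Fact p.Prime] (a : ℂ_[p]) {r : ℝ}
    (hr : 0 < r) : ∃ x : PadicAlgCl p, ‖(x : ℂ_[p]) - a‖ < r := by
  obtain ⟨x, hx⟩ := Metric.denseRange_iff.1
    (UniformSpace.Completion.denseRange_coe (α := PadicAlgCl p)) a r hr
  exact ⟨x, by rwa [← dist_eq_norm, dist_comm]⟩

theorem isConjRoot_mem_of_isDefinedOver {p : ℕ} [Fact p.Prime]
    {E : IntermediateField ℚ_[p] (PadicAlgCl p)} {D : Set ℂ_[p]} (h : IsDefinedOver E D)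
    {x y : PadicAlgCl p} (hx : (x : ℂ_[p]) ∈ D) (hxy : IsConjRoot E x y) : (y : ℂ_[p]) ∈ D := by
  have : Normal E (PadicAlgCl p) := inferInstance
  obtain ⟨σ, rfl⟩ := hxy.symm.exists_algEquiv
  rw [← galoisAction_coe, ← h σ]
  exact ⟨x, hx, rfl⟩

theorem isGaloisDisk_setOf_coe_mem {p : ℕ} [Fact p.Prime]
    {E : IntermediateField ℚ_[p] (PadicAlgCl p)} {D : Set ℂ_[p]} (hD : IsPadicDisk D)
    (h : IsDefinedOver E D) (hne : ∃ x : PadicAlgCl p, (x : ℂ_[p]) ∈ D) :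
    IsGaloisDisk E {x | (x : ℂ_[p]) ∈ D} where
  nonempty := hne
  isConjRoot_mem _ hx _ hxy := isConjRoot_mem_of_isDefinedOver h hx hxy
  norm_sub_lt x hx y hy z hz := by
    rw [← PadicComplex.norm_coe_sub_coe, ← PadicComplex.norm_coe_sub_coe]
    have hxy : ∀ a : ℂ_[p], ‖(x : ℂ_[p]) - y‖ ≤ max ‖(x : ℂ_[p]) - a‖ ‖(y : ℂ_[p]) - a‖ := by
      intro a
      have := IsUltrametricDist.norm_add_le_max ((x : ℂ_[p]) - a) (a - y)
      rwa [sub_add_sub_cancel, norm_sub_rev a] at this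
    have hxz : ∀ a : ℂ_[p], ‖(z : ℂ_[p]) - a‖ ≤ max ‖(x : ℂ_[p]) - z‖ ‖(x : ℂ_[p]) - a‖ := by
      intro a
      have := IsUltrametricDist.norm_add_le_max ((z : ℂ_[p]) - x) (x - a)
      rwa [sub_add_sub_cancel, norm_sub_rev (z : ℂ_[p]) x] at this
    obtain ⟨-, a, r, rfl | rfl⟩ := hD
    · simp only [Set.mem_ofPred_eq, not_lt] at hx hy hz
      refine (hxy a).trans_lt ((max_lt hx hy).trans_le ?_)
      exact (le_max_iff.1 (hz.trans (hxz a))).elim id fun h => absurd hx (not_lt.2 h)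
    · simp only [Set.mem_ofPred_eq, not_le] at hx hy hz
      refine (hxy a).trans_lt ((max_le hx hy).trans_lt ?_)
      exact (lt_max_iff.1 (hz.trans_le (hxz a))).elim id fun h => absurd hx (not_le.2 h)

/-! ### The Ax-Sen-Tate theorem -/

/-- The binomial coefficient has `p`-adic valuation exactly `1`. It bounds the loss in Ax's
argument, where the degree is a power of `p`. -/
theorem one_le_mul_norm_choose_prime_pow {p : ℕ} [hp : Fact p.Prime] (k : ℕ) :
    1 ≤ (p : ℝ) * ‖(((p ^ (k + 1)).choose (p ^ k) : ℕ) : PadicAlgCl p)‖ := by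
  have hpp : (0 : ℝ) < p := by exact_mod_cast hp.out.pos
  have hle : p ^ k ≤ p ^ (k + 1) := Nat.pow_le_pow_right hp.out.pos k.le_succ
  have hfac := Nat.factorization_choose_prime_pow hp.out hle (pow_ne_zero k hp.out.ne_zero)
  rw [hp.out.factorization_pow, Finsupp.single_eq_same, Nat.add_sub_cancel_left] at hfac
  rw [PadicAlgCl.norm_natCast]
  by_contra! hlt
  have h1 : ‖(((p ^ (k + 1)).choose (p ^ k) : ℕ) : ℚ_[p])‖ < (p : ℝ) ^ (-(2 : ℕ) + 1 : ℤ) := by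
    have : (-(2 : ℕ) + 1 : ℤ) = -1 := by norm_num
    rw [this, zpow_neg_one, ← one_div, lt_div_iff₀ hpp, mul_comm]
    exact hlt
  rw [← Padic.norm_le_pow_iff_norm_lt_pow_add_one] at h1
  have h2 : p ^ 2 ∣ (p ^ (k + 1)).choose (p ^ k) := by
    have := (Padic.norm_int_le_pow_iff_dvd (((p ^ (k + 1)).choose (p ^ k) : ℕ) : ℤ) 2).1
      (by exact_mod_cast h1)
    exact_mod_cast this
  have := (hp.out.pow_dvd_iff_le_factorization (Nat.choose_pos hle).ne').1 h2
  omega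

theorem isPadicDisk_closedBall {p : ℕ} [Fact p.Prime] (a : ℂ_[p]) {r : ℝ} (hr : 0 ≤ r) :
    IsPadicDisk {x : ℂ_[p] | ‖x - a‖ ≤ r} :=
  ⟨⟨a, by simpa using hr⟩, a, r, Or.inr rfl⟩

theorem isDefinedOver_closedBall {p : ℕ} [Fact p.Prime]
    {E : IntermediateField ℚ_[p] (PadicAlgCl p)} {a : ℂ_[p]}
    (ha : ∀ σ : PadicAlgCl p ≃ₐ[E] PadicAlgCl p, galoisAction σ a = a) (r : ℝ) :
    IsDefinedOver E {x : ℂ_[p] | ‖x - a‖ ≤ r} := by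
  have hsub (σ : PadicAlgCl p ≃ₐ[E] PadicAlgCl p) (x : ℂ_[p]) :
      ‖galoisAction σ x - a‖ = ‖x - a‖ := by
    rw [← dist_eq_norm, ← dist_eq_norm, ← (isometry_galoisAction σ).dist_eq x a, ha]
  have hinv (σ : PadicAlgCl p ≃ₐ[E] PadicAlgCl p) (x : ℂ_[p]) :
      galoisAction σ (galoisAction σ.symm x) = x := by
    refine UniformSpace.Completion.induction_on x (isClosed_eq
      ((isometry_galoisAction σ).continuous.comp (isometry_galoisAction σ.symm).continuous)
      continuous_id) fun y => ?_
    rw [galoisAction_coe, galoisAction_coe, AlgEquiv.apply_symm_apply]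
  intro σ
  ext x
  constructor
  · rintro ⟨y, hy, rfl⟩
    exact (hsub σ y).le.trans hy
  · intro hx
    exact ⟨galoisAction σ.symm x, (hsub σ.symm x).le.trans hx, hinv σ x⟩

/-- Ax's approximation argument. -/
theorem exists_mem_norm_coe_sub_le {p : ℕ} [hp : Fact p.Prime]
    {E : IntermediateField ℚ_[p] (PadicAlgCl p)} {a : ℂ_[p]}
    (ha : ∀ σ : PadicAlgCl p ≃ₐ[E] PadicAlgCl p, galoisAction σ a = a) (k : ℕ) {r : ℝ}
    (hr : 0 < r) {x : PadicAlgCl p} (hx : ‖(x : ℂ_[p]) - a‖ ≤ r)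
    (hdeg : (minpoly E x).natDegree < p ^ (k + 1)) :
    ∃ b ∈ E, ‖(b : ℂ_[p]) - a‖ ≤ r * (p : ℝ) ^ (2 - 2 * (1 / 2 : ℝ) ^ k) := by
  have hp1 : (1 : ℝ) < p := by exact_mod_cast hp.out.one_lt
  have hp0 : (0 : ℝ) < p := one_pos.trans hp1
  induction k generalizing r x with
  | zero =>
    have hS := isGaloisDisk_setOf_coe_mem (isPadicDisk_closedBall a hr.le)
      (isDefinedOver_closedBall ha r) ⟨x, hx⟩
    obtain ⟨y, hy⟩ := hS.exists_isMinDegree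
    obtain ⟨j, hj⟩ := hS.natDegree_minpoly_eq_pow hy
    have hjlt : p ^ j < p ^ (0 + 1) := hj ▸ (hy.2 x hx).trans_lt hdeg
    have hj0 : j = 0 := by
      have := (Nat.pow_lt_pow_iff_right hp.out.one_lt).1 hjlt
      omega
    rw [hj0, pow_zero, minpoly.natDegree_eq_one_iff] at hj
    obtain ⟨b, rfl⟩ := hj
    refine ⟨b, b.2, ?_⟩
    have : (2 : ℝ) - 2 * (1 / 2) ^ 0 = 0 := by norm_num
    rw [this, Real.rpow_zero, mul_one]
    exact hy.1
  | succ k ih =>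
    have hS := isGaloisDisk_setOf_coe_mem (isPadicDisk_closedBall a hr.le)
      (isDefinedOver_closedBall ha r) ⟨x, hx⟩
    obtain ⟨y, hy⟩ := hS.exists_isMinDegree
    obtain ⟨j, hj⟩ := hS.natDegree_minpoly_eq_pow hy
    have hjlt : p ^ j < p ^ (k + 1 + 1) := hj ▸ (hy.2 x hx).trans_lt hdeg
    have hjk : j < k + 1 + 1 := (Nat.pow_lt_pow_iff_right hp.out.one_lt).1 hjlt
    -- `t` is the loss of one step; the exponents `(1 / 2) ^ i` sum to `2 - 2 * (1 / 2) ^ k`, which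
    -- stays below `2`.
    set t : ℝ := (p : ℝ) ^ ((1 / 2 : ℝ) ^ k) with ht
    have ht1 : 1 ≤ t := Real.one_le_rpow hp1.le (by positivity)
    have hrt : r ≤ r * t := le_mul_of_one_le_right hr.le ht1
    have hC : r * (p : ℝ) ^ (2 - 2 * (1 / 2 : ℝ) ^ (k + 1)) =
        r * t * (p : ℝ) ^ (2 - 2 * (1 / 2 : ℝ) ^ k) := by
      rw [ht, mul_assoc, ← Real.rpow_add hp0]
      congr 2
      ring
    rw [hC]
    rcases Nat.lt_or_ge j (k + 1) with hj' | hj'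
    · exact ih (hr.trans_le hrt) (hy.1.trans hrt)
        (hj ▸ Nat.pow_lt_pow_right hp.out.one_lt hj')
    · obtain rfl : j = k + 1 := by omega
      -- In degree exactly `p ^ (k + 1)`, a root of the Hasse derivative of order `p ^ k` has
      -- smaller degree and is at distance at most `r * t`.
      have hq : p ^ k < (minpoly E y).natDegree :=
        hj ▸ Nat.pow_lt_pow_right hp.out.one_lt k.lt_succ_self
      obtain ⟨c, hcdeg, hc⟩ := exists_natDegree_minpoly_le hq hr.le fun b hb => by
        have hbS : ‖(b : ℂ_[p]) - a‖ ≤ r := hS.isConjRoot_mem y hy.1 b hb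
        have hyS : ‖(y : ℂ_[p]) - a‖ ≤ r := hy.1
        rw [← PadicComplex.norm_coe_sub_coe]
        have := IsUltrametricDist.norm_add_le_max ((y : ℂ_[p]) - a) (a - b)
        rw [sub_add_sub_cancel, norm_sub_rev a] at this
        exact this.trans (max_le hyS hbS)
      have hpk : 0 < p ^ k := pow_pos hp.out.pos k
      have hlt : (minpoly E c).natDegree < p ^ (k + 1) := by omega
      refine ih (x := c) (hr.trans_le hrt) ?_ hlt
      rw [hj] at hc
      have hM : 2 ^ k ≤ p ^ (k + 1) - p ^ k := by
        have h2 : 2 ^ k ≤ p ^ k := Nat.pow_le_pow_left hp.out.two_le k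
        have h3 : p ^ k * 2 ≤ p ^ (k + 1) := Nat.mul_le_mul_left _ hp.out.two_le
        omega
      set M := p ^ (k + 1) - p ^ k
      have hM0 : M ≠ 0 := by
        have : 0 < 2 ^ k := by positivity
        omega
      have htM : (p : ℝ) ≤ t ^ M := by
        have h2 : t ^ 2 ^ k = p := by
          rw [ht, ← Real.rpow_natCast, ← Real.rpow_mul hp0.le]
          push_cast
          rw [← mul_pow]
          norm_num
        rw [← h2]
        exact pow_le_pow_right₀ ht1 hM
      have hcy : ‖y - c‖ ≤ r * t := by
        refine le_of_pow_le_pow_left₀ hM0 (by positivity) ?_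
        have h1 := one_le_mul_norm_choose_prime_pow (p := p) k
        calc ‖y - c‖ ^ M ≤ (p * ‖(((p ^ (k + 1)).choose (p ^ k) : ℕ) : PadicAlgCl p)‖) *
              ‖y - c‖ ^ M := le_mul_of_one_le_left (by positivity) h1
          _ = p * (‖(((p ^ (k + 1)).choose (p ^ k) : ℕ) : PadicAlgCl p)‖ * ‖y - c‖ ^ M) := by ring
          _ ≤ t ^ M * r ^ M := mul_le_mul htM hc (by positivity) (by positivity)
          _ = (r * t) ^ M := by ring
      have := IsUltrametricDist.norm_add_le_max ((c : ℂ_[p]) - y) (y - a)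
      rw [sub_add_sub_cancel, PadicComplex.norm_coe_sub_coe, norm_sub_rev c] at this
      exact this.trans (max_le hcy (le_trans hy.1 hrt))

/-- The Ax-Sen-Tate theorem for a finite extension `E` of `ℚ_[p]`. -/
theorem exists_coe_eq_of_forall_galoisAction_eq {p : ℕ} [hp : Fact p.Prime]
    {E : IntermediateField ℚ_[p] (PadicAlgCl p)} [FiniteDimensional ℚ_[p] E] {a : ℂ_[p]}
    (ha : ∀ σ : PadicAlgCl p ≃ₐ[E] PadicAlgCl p, galoisAction σ a = a) :
    ∃ b ∈ E, (b : ℂ_[p]) = a := by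
  have hp1 : (1 : ℝ) < p := by exact_mod_cast hp.out.one_lt
  have hp0 : (0 : ℝ) < p := one_pos.trans hp1
  have hfin : FiniteDimensional ℚ_[p] (Subalgebra.toSubmodule E.toSubalgebra) :=
    ‹FiniteDimensional ℚ_[p] E›
  have hcl : IsClosed ((fun x : PadicAlgCl p => (x : ℂ_[p])) '' (E : Set (PadicAlgCl p))) := by
    refine IsComplete.isClosed ?_
    rw [isComplete_image_iff UniformSpace.Completion.coe_isometry.isUniformInducing]
    exact (Subalgebra.toSubmodule E.toSubalgebra).complete_of_finiteDimensional
  have : a ∈ closure ((fun x : PadicAlgCl p => (x : ℂ_[p])) '' (E : Set (PadicAlgCl p))) := by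
    rw [Metric.mem_closure_iff]
    intro ε hε
    have hr : 0 < ε / (2 * (p : ℝ) ^ (2 : ℝ)) := by positivity
    obtain ⟨x, hx⟩ := PadicComplex.exists_norm_coe_sub_lt a hr
    obtain ⟨b, hbE, hb⟩ := exists_mem_norm_coe_sub_le ha (minpoly E x).natDegree hr hx.le
      ((Nat.lt_pow_self hp.out.one_lt).trans (Nat.pow_lt_pow_right hp.out.one_lt (Nat.lt_succ_self _)))
    refine ⟨b, ⟨b, hbE, rfl⟩, ?_⟩
    rw [dist_comm, dist_eq_norm]
    refine hb.trans_lt ?_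
    have hle : (p : ℝ) ^ (2 - 2 * (1 / 2 : ℝ) ^ (minpoly E x).natDegree) ≤ (p : ℝ) ^ (2 : ℝ) :=
      Real.rpow_le_rpow_of_exponent_le hp1.le (by
        have : (0 : ℝ) < (1 / 2) ^ (minpoly E x).natDegree := by positivity
        linarith)
    refine (mul_le_mul_of_nonneg_left hle hr.le).trans_lt ?_
    have h2 : (0 : ℝ) < (p : ℝ) ^ (2 : ℝ) := by positivity
    have : ε / (2 * (p : ℝ) ^ (2 : ℝ)) * (p : ℝ) ^ (2 : ℝ) = ε / 2 := by
      field_simp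
    rw [this]
    linarith
  rw [hcl.closure_eq] at this
  exact this

theorem exists_coe_mem_of_isDefinedOver {p : ℕ} [hp : Fact p.Prime]
    {E : IntermediateField ℚ_[p] (PadicAlgCl p)} [FiniteDimensional ℚ_[p] E] {D : Set ℂ_[p]}
    (hD : IsPadicDisk D) (h : IsDefinedOver E D) : ∃ x : PadicAlgCl p, (x : ℂ_[p]) ∈ D := by
  obtain ⟨⟨d, hd⟩, a, r, hDr⟩ := hD
  -- Only the closed disk of radius `0` needs Ax-Sen-Tate: its centre is Galois-fixed.
  rcases lt_trichotomy r 0 with hr | rfl | hr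
  · exfalso
    have := norm_nonneg (d - a)
    rcases hDr with rfl | rfl
    · exact absurd (this.trans_lt hd) (not_lt.2 hr.le)
    · exact absurd (this.trans hd) (not_le.2 hr)
  · rcases hDr with rfl | rfl
    · exact absurd ((norm_nonneg (d - a)).trans_lt hd) (lt_irrefl _)
    · have hsingle : {x : ℂ_[p] | ‖x - a‖ ≤ 0} = {a} := by
        ext x
        simp [sub_eq_zero]
      rw [hsingle] at h ⊢
      obtain ⟨b, -, hb⟩ := exists_coe_eq_of_forall_galoisAction_eq fun σ => by
        have := h σ
        rwa [Set.image_singleton, Set.singleton_eq_singleton_iff] at this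
      exact ⟨b, hb⟩
  · obtain ⟨x, hx⟩ := PadicComplex.exists_norm_coe_sub_lt a hr
    refine ⟨x, ?_⟩
    rcases hDr with rfl | rfl
    · exact hx
    · exact hx.le

/-! ### The main theorem -/

open IntermediateField in
theorem mainTheorem10 (p : ℕ) [Fact p.Prime]
    (E : IntermediateField ℚ_[p] (PadicAlgCl p)) [FiniteDimensional ℚ_[p] E]
    (D : Set ℂ_[p]) (hD : IsPadicDisk D) (hDE : IsDefinedOver E D) :
    ∃ s : ℕ,
      IsLeast {e : ℕ | ∃ F : IntermediateField E (PadicAlgCl p),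
        FiniteDimensional E F ∧ ramificationIndex E F = e ∧ Meets F D} (p ^ s) ∧
      (∃ F : IntermediateField E (PadicAlgCl p), FiniteDimensional E F ∧ Meets F D ∧
        (Module.finrank E F : ℝ) ≤ max 1 ((p : ℝ) ^ (2 * (s : ℤ) - 1))) ∧
      (s ≤ 1 → ∀ F : IntermediateField E (PadicAlgCl p), FiniteDimensional E F → Meets F D →
        (Module.finrank E F : ℝ) ≤ max 1 ((p : ℝ) ^ (2 * (s : ℤ) - 1)) →
        IsTotallyRamified E F) := by
  have hp1 : (1 : ℝ) < p := by exact_mod_cast (Fact.out : p.Prime).one_lt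
  have hS := isGaloisDisk_setOf_coe_mem hD hDE (exists_coe_mem_of_isDefinedOver hD hDE)
  obtain ⟨a, ha⟩ := hS.exists_isMinDegree
  obtain ⟨s, hs⟩ := hS.natDegree_minpoly_eq_pow ha
  have hint : IsIntegral E a := Algebra.IsIntegral.isIntegral a
  have hfin : FiniteDimensional E E⟮a⟯ := adjoin.finiteDimensional hint
  have hrank : Module.finrank E E⟮a⟯ = p ^ s := (adjoin.finrank hint).trans hs
  have hram : ramificationIndex E E⟮a⟯ = p ^ s :=
    le_antisymm (hrank ▸ (ramificationIndex_ne_zero_and_le E E⟮a⟯).2)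
      (hrank ▸ hS.finrank_adjoin_le_ramificationIndex ha)
  have hmeets : Meets E⟮a⟯ D := ⟨a, mem_adjoin_simple_self E a, ha.1⟩
  have hmin : ∀ F : IntermediateField E (PadicAlgCl p), FiniteDimensional E F → Meets F D →
      p ^ s ≤ ramificationIndex E F := by
    rintro F _ ⟨x, hxF, hx⟩
    rw [← hram]
    exact ramificationIndex_le_of_le (hS.valueGroup_adjoin_le ha hxF hx)
  refine ⟨s, ⟨⟨E⟮a⟯, hfin, hram, hmeets⟩, ?_⟩, ⟨E⟮a⟯, hfin, hmeets, ?_⟩, ?_⟩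
  · rintro _ ⟨F, hF, rfl, hFD⟩
    exact hmin F hF hFD
  · rw [hrank]
    rcases s.eq_zero_or_pos with rfl | hs0
    · simp
    · refine le_max_of_le_right ?_
      push_cast
      rw [← zpow_natCast]
      exact zpow_le_zpow_right₀ hp1.le (by omega)
  · intro hs1 F hF hFD hle
    have hle' : Module.finrank E F ≤ p ^ s := by
      -- For `s ≤ 1` the bound is exactly `p ^ s`, which squeezes `[F : E]` against the ramification
      -- index.
      have : max 1 ((p : ℝ) ^ (2 * (s : ℤ) - 1)) = (p : ℝ) ^ s := by
        interval_cases s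
        · simpa using inv_le_one_of_one_le₀ hp1.le
        · simpa using hp1.le
      rw [this] at hle
      exact_mod_cast hle
    exact le_antisymm (ramificationIndex_ne_zero_and_le E F).2 (hle'.trans (hmin F hF hFD))
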